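/- Let $n,q\ge 1$. Identify $\mathbb C^n$ with $\mathbb R^{2n}$, with Euclidean norm and Lebesgue measure. Let $H\subset\mathbb R^{2n}=\mathbb C^n$ be a (nonempty) real affine subspace of real codimension $m\ge 3$, and put $d_H(z)=\inf_{w\in H}|z-w|$. A $(0,q)$-form is written $v=\sum'_{|J|=q}v_J\,d\bar z_J$, the sum being over strictly increasing multi-indices $J=(j_1<\dots<j_q)$ in $\{1,\dots,n\}$, with measurable coefficients $v_J:\mathbb C^n\to\mathbb C$ and $|v|^2=\sum'_J|v_J|^2$; the operator $\bar\partial v=\sum'_J\sum_{j=1}^n\frac{\partial v_J}{\partial\bar z_j}\,d\bar z_j\wedge d\bar z_J$ is understood in the sense of distributions. Then for every $(0,q)$-form $v$ on $\mathbb C^n$ with $\bar\partial v=0$, $\int_{\mathbb C^n}|v|^2<\infty$ and $\int_{\mathbb C^n}|v|^2d_H^2<\infty$, there exists a square-integrable $(0,q-1)$-form $u$ on $\mathbb C^n$ such that $\bar\partial u=v$ and $$\int_{\mathbb C^n}|u|^2\le\frac{16}{(m-2)^2}\int_{\mathbb C^n}|v|^2\,d_H^2 .$$ -/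

import Mathlib

open MeasureTheory

/-- `ℂⁿ` with its Euclidean norm; as a real inner product space it is `ℝ²ⁿ`, and `volume` is
Lebesgue measure. -/
abbrev Cn (n : ℕ) : Type := EuclideanSpace ℂ (Fin n)

/-- Strictly increasing multi-indices `J = (j₁ < ⋯ < j_q)` with entries in `Fin n`, encoded by
their underlying sets. -/
abbrev MultiIndex (n q : ℕ) : Type := {J : Finset (Fin n) // J.card = q}

/-- A `(0,q)`-form `∑'_J u_J dz̄_J` on `ℂⁿ`, given by its coefficient functions with respect to
the frame `dz̄_J = dz̄_{j₁} ∧ ⋯ ∧ dz̄_{j_q}`, `j₁ < ⋯ < j_q`. No regularity is built in. -/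
abbrev AntiForm (n q : ℕ) : Type := MultiIndex n q → Cn n → ℂ

/-- The Wirtinger derivative `∂φ/∂z̄_j = ½ (∂φ/∂x_j + i ∂φ/∂y_j)`. -/
noncomputable def dzbar {n : ℕ} (j : Fin n) (φ : Cn n → ℂ) (z : Cn n) : ℂ :=
  (1 / 2 : ℂ) * (fderiv ℝ φ z (EuclideanSpace.single j 1)
    + Complex.I * fderiv ℝ φ z (EuclideanSpace.single j Complex.I))

/-- The multi-index `K ∖ {j}` for `j ∈ K`. -/
def MultiIndex.erase {n q : ℕ} (K : MultiIndex n (q + 1)) (j : K.1) : MultiIndex n q :=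
  ⟨K.1.erase j.1, by rw [Finset.card_erase_of_mem j.2, K.2]; rfl⟩

/-- The sign in `dz̄_j ∧ dz̄_{K ∖ {j}} = ± dz̄_K`: the parity of the number of entries of `K`
that are smaller than `j`. -/
def wedgeSign {n : ℕ} (j : Fin n) (K : Finset (Fin n)) : ℂ :=
  (-1) ^ (K.filter (fun k => k < j)).card

/-- `∂̄u = f` in the sense of distributions, for forms with locally integrable coefficients.
Since `∂̄u = ∑_J ∑_j (∂u_J/∂z̄_j) dz̄_j ∧ dz̄_J`, the coefficient of `∂̄u` at `K` is
`∑_{j ∈ K} ± ∂u_{K ∖ {j}}/∂z̄_j`; the derivatives are moved to a smooth compactly supported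
test function `φ`. -/
def IsDbar {n q : ℕ} (u : AntiForm n q) (f : AntiForm n (q + 1)) : Prop :=
  (∀ J, LocallyIntegrable (u J) volume) ∧ (∀ K, LocallyIntegrable (f K) volume) ∧
    ∀ (K : MultiIndex n (q + 1)) (φ : Cn n → ℂ),
      ContDiff ℝ (⊤ : ℕ∞) φ → HasCompactSupport φ →
        ∫ z, f K z * φ z =
          -∑ j : K.1, wedgeSign j.1 K.1 * ∫ z, u (K.erase j) z * dzbar j.1 φ z

/-- `∂̄v = 0` in the sense of distributions. -/
def IsDbarClosed {n q : ℕ} (v : AntiForm n q) : Prop :=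
  IsDbar v (fun _ _ => 0)

/-- The pointwise squared norm `|u|² = ∑'_J |u_J|²`. -/
noncomputable def AntiForm.normSq {n q : ℕ} (u : AntiForm n q) (z : Cn n) : ℝ :=
  ∑ J, ‖u J z‖ ^ 2

/-- `u` is a square integrable form: all its coefficients are in `L²`. -/
def AntiForm.IsL2 {n q : ℕ} (u : AntiForm n q) : Prop :=
  ∀ J, MemLp (u J) 2 volume

/-
On Schwartz functions `g`, the vector field `x / (|x|² + δ)` in the `m` normal directions of `H`
gives, as `δ → 0`, the Hardy inequality `∫ |g|² / d_H² ≤ 4 / (m - 2)² ∫ |∇g|²`. Dually, an `L²`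
function `f` with `f d_H ∈ L²` has a Fourier transform of the form `|ξ| F` with `F ∈ L²` and
`∫ |F|² ≤ 4π² · 4 / (m - 2)² ∫ |f|² d_H²`. On the Fourier side `∂̄` is the exterior product with
`πiξ`. The Koszul homotopy, contraction with the conjugate of `πiξ` divided by `π² |ξ|²`, therefore
solves `∂̄u = v` with `|û| = |v̂| / (π |ξ|) = |F| / π`, whence the constant `16 / (m - 2)²`.
-/

open SchwartzMap FourierTransform Filter Topology
open scoped LineDeriv

section IntegrationByParts

variable {V F : Type*} [NormedAddCommGroup V] [InnerProductSpace ℝ V] [NormedAddCommGroup F]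
  [InnerProductSpace ℝ F]

lemma hasLineDerivAt_norm_sq_schwartz (g : 𝓢(V, F)) (z e : V) :
    HasLineDerivAt ℝ (fun z => ‖g z‖ ^ 2) (2 * inner ℝ (g z) (∂_{e} g z)) z e := by
  simpa [SchwartzMap.lineDerivOp_apply_eq_fderiv, mul_add] using
    ((g.hasFDerivAt z).norm_sq).hasLineDerivAt e

variable [FiniteDimensional ℝ V] [MeasurableSpace V] [BorelSpace V]

lemma integrable_norm_sq_schwartz (g : 𝓢(V, F)) : Integrable fun z => ‖g z‖ ^ 2 :=
  (g.memLp 2).integrable_norm_pow two_ne_zero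

lemma integrable_inner_schwartz (g h : 𝓢(V, F)) : Integrable fun z => inner ℝ (g z) (h z) :=
  ((g.memLp 2).norm.integrable_mul (h.memLp 2).norm).mono'
    (g.continuous.inner h.continuous).aestronglyMeasurable
    (.of_forall fun z => norm_inner_le_norm (g z) (h z))

lemma integral_mul_lineDeriv_norm_sq {X X' : V → ℝ} {e : V} {c c' : ℝ}
    (hX : ∀ z, HasLineDerivAt ℝ X (X' z) z e) (hXm : AEStronglyMeasurable X)
    (hXc : ∀ z, |X z| ≤ c) (hXm' : AEStronglyMeasurable X') (hXc' : ∀ z, |X' z| ≤ c')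
    (g : 𝓢(V, F)) :
    ∫ z, X z * (2 * inner ℝ (g z) (∂_{e} g z)) = -∫ z, X' z * ‖g z‖ ^ 2 :=
  integral_bilinear_hasLineDerivAt_right_eq_neg_left_of_integrable
    (B := ContinuousLinearMap.mul ℝ ℝ)
    ((integrable_norm_sq_schwartz g).bdd_mul hXm' (.of_forall hXc'))
    (((integrable_inner_schwartz g (∂_{e} g)).const_mul 2).bdd_mul hXm (.of_forall hXc))
    ((integrable_norm_sq_schwartz g).bdd_mul hXm (.of_forall hXc))
    (fun z _ => hX z) (fun z _ => hasLineDerivAt_norm_sq_schwartz g z e)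

/- Integrate `0 ≤ ‖∂ₑg + X g‖²` and move the derivative in the cross term onto `X`. -/
lemma integral_deriv_sub_sq_mul_norm_sq_le {X X' : V → ℝ} {e : V} {c c' : ℝ}
    (hX : ∀ z, HasLineDerivAt ℝ X (X' z) z e) (hXm : AEStronglyMeasurable X)
    (hXc : ∀ z, |X z| ≤ c) (hXm' : AEStronglyMeasurable X') (hXc' : ∀ z, |X' z| ≤ c')
    (g : 𝓢(V, F)) :
    ∫ z, (X' z - X z ^ 2) * ‖g z‖ ^ 2 ≤ ∫ z, ‖∂_{e} g z‖ ^ 2 := by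
  have hg := integrable_norm_sq_schwartz g
  have hdg := integrable_norm_sq_schwartz (∂_{e} g)
  have hX'g : Integrable fun z => X' z * ‖g z‖ ^ 2 := hg.bdd_mul hXm' (.of_forall hXc')
  have hXg : Integrable fun z => X z ^ 2 * ‖g z‖ ^ 2 := by
    refine hg.bdd_mul (hXm.pow 2) (c := c ^ 2) (.of_forall fun z => ?_)
    rw [norm_pow]
    exact pow_le_pow_left₀ (norm_nonneg _) (hXc z) 2
  have hcross : Integrable fun z => X z * (2 * inner ℝ (g z) (∂_{e} g z)) :=
    ((integrable_inner_schwartz g (∂_{e} g)).const_mul 2).bdd_mul hXm (.of_forall hXc)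
  have hsq : ∀ z, -(X z ^ 2 * ‖g z‖ ^ 2) ≤
      ‖∂_{e} g z‖ ^ 2 + X z * (2 * inner ℝ (g z) (∂_{e} g z)) := fun z => by
    have h := norm_add_sq_real (∂_{e} g z) (X z • g z)
    rw [inner_smul_right, norm_smul, mul_pow, Real.norm_eq_abs, sq_abs, real_inner_comm] at h
    linarith [sq_nonneg ‖∂_{e} g z + X z • g z‖]
  have hint := integral_mono hXg.neg (hdg.add hcross) hsq
  simp only [Pi.neg_apply, Pi.add_apply] at hint
  rw [integral_neg, integral_add hdg hcross,
    integral_mul_lineDeriv_norm_sq hX hXm hXc hXm' hXc'] at hint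
  simp only [sub_mul]
  rw [integral_sub hX'g hXg]
  linarith

end IntegrationByParts

section Hardy

variable {V : Type*} [NormedAddCommGroup V] [InnerProductSpace ℝ V] {ι : Type*} [Fintype ι]

/-- The squared distance to the affine subspace through `a` orthogonal to the orthonormal
family `e`. -/
noncomputable def sqDist (e : ι → V) (a z : V) : ℝ := ∑ i, inner ℝ (e i) (z - a) ^ 2

lemma sqDist_nonneg (e : ι → V) (a z : V) : 0 ≤ sqDist e a z :=
  Finset.sum_nonneg fun _ _ => sq_nonneg _

@[fun_prop]
lemma continuous_sqDist (e : ι → V) (a : V) : Continuous (sqDist e a) := by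
  unfold sqDist; fun_prop

lemma sq_inner_le_sqDist (e : ι → V) (a z : V) (i : ι) :
    inner ℝ (e i) (z - a) ^ 2 ≤ sqDist e a z :=
  Finset.single_le_sum (f := fun i => inner ℝ (e i) (z - a) ^ 2) (fun _ _ => sq_nonneg _)
    (Finset.mem_univ i)

lemma hasLineDerivAt_inner_sub (x a z e : V) :
    HasLineDerivAt ℝ (fun z => inner ℝ x (z - a)) (inner ℝ x e) z e := by
  simpa [Function.comp_def] using
    ((innerSL ℝ x).hasFDerivAt.comp z ((hasFDerivAt_id z).sub_const a)).hasLineDerivAt e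

lemma hasLineDerivAt_sqDist {e : ι → V} (he : Orthonormal ℝ e) (a z : V) (i : ι) :
    HasLineDerivAt ℝ (sqDist e a) (2 * inner ℝ (e i) (z - a)) z (e i) := by
  classical
  refine (HasDerivAt.fun_sum (u := Finset.univ) fun j _ =>
    (hasLineDerivAt_inner_sub (e j) a z (e i)).pow 2).congr_deriv ?_
  rw [Finset.sum_eq_single i]
  · simp [he.1 i]
  · intro j _ hj
    simp [he.2 hj]
  · simp

/-- The `i`-th coordinate of the vector field `c x / (|x|² + δ)`, where `x` is the component of
`z - a` along the family `e`. At `δ = 0` it is the logarithmic gradient of `|x|ᶜ`. -/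
noncomputable def hardyField (e : ι → V) (a : V) (c δ : ℝ) (i : ι) (z : V) : ℝ :=
  c * inner ℝ (e i) (z - a) / (sqDist e a z + δ)

/-- The derivative of `hardyField e a c δ i` in direction `e i`. -/
noncomputable def hardyFieldDeriv (e : ι → V) (a : V) (c δ : ℝ) (i : ι) (z : V) : ℝ :=
  c / (sqDist e a z + δ) - 2 * c * inner ℝ (e i) (z - a) ^ 2 / (sqDist e a z + δ) ^ 2

variable {δ : ℝ}

lemma sqDist_add_pos (e : ι → V) (a : V) (hδ : 0 < δ) (z : V) : 0 < sqDist e a z + δ :=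
  add_pos_of_nonneg_of_pos (sqDist_nonneg e a z) hδ

lemma hasLineDerivAt_hardyField {e : ι → V} (he : Orthonormal ℝ e) (a : V) (c : ℝ) (hδ : 0 < δ)
    (i : ι) (z : V) :
    HasLineDerivAt ℝ (hardyField e a c δ i) (hardyFieldDeriv e a c δ i z) z (e i) := by
  have hpos := sqDist_add_pos e a hδ z
  refine (((hasLineDerivAt_inner_sub (e i) a z (e i)).const_mul c).div
    ((hasLineDerivAt_sqDist he a z i).add_const δ) (by simpa using hpos.ne')).congr_deriv ?_
  simp only [zero_smul, add_zero, real_inner_self_eq_norm_sq, he.1 i, hardyFieldDeriv]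
  field_simp

lemma continuous_hardyField (e : ι → V) (a : V) (c : ℝ) (hδ : 0 < δ) (i : ι) :
    Continuous (hardyField e a c δ i) :=
  .div (by fun_prop) (by fun_prop) fun z => (sqDist_add_pos e a hδ z).ne'

lemma continuous_hardyFieldDeriv (e : ι → V) (a : V) (c : ℝ) (hδ : 0 < δ) (i : ι) :
    Continuous (hardyFieldDeriv e a c δ i) :=
  .sub (.div (by fun_prop) (by fun_prop) fun z => (sqDist_add_pos e a hδ z).ne')
    (.div (by fun_prop) (by fun_prop) fun z => pow_ne_zero 2 (sqDist_add_pos e a hδ z).ne')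

lemma abs_hardyField_le (e : ι → V) (a : V) (c : ℝ) (hδ : 0 < δ) (i : ι) (z : V) :
    |hardyField e a c δ i z| ≤ |c| * (1 + 1 / δ) := by
  have hpos := sqDist_add_pos e a hδ z
  have hx : |inner ℝ (e i) (z - a)| ≤ sqDist e a z + 1 := by
    nlinarith [sq_abs (inner ℝ (e i) (z - a)), sq_nonneg (|inner ℝ (e i) (z - a)| - 1),
      abs_nonneg (inner ℝ (e i) (z - a)), sq_inner_le_sqDist e a z i]
  rw [hardyField, abs_div, abs_of_pos hpos, abs_mul, mul_div_assoc]
  gcongr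
  calc _ ≤ (sqDist e a z + 1) / (sqDist e a z + δ) := by gcongr
    _ ≤ 1 + 1 / δ := by
      rw [add_div]
      gcongr
      · exact div_le_one_of_le₀ (by linarith) hpos.le
      · exact le_add_of_nonneg_left (sqDist_nonneg e a z)

lemma abs_hardyFieldDeriv_le (e : ι → V) (a : V) (c : ℝ) (hδ : 0 < δ) (i : ι) (z : V) :
    |hardyFieldDeriv e a c δ i z| ≤ |c| * (3 / δ) := by
  have hpos := sqDist_add_pos e a hδ z
  have hinv : 1 / (sqDist e a z + δ) ≤ 1 / δ :=
    one_div_le_one_div_of_le hδ (le_add_of_nonneg_left (sqDist_nonneg e a z))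
  have hle : inner ℝ (e i) (z - a) ^ 2 / (sqDist e a z + δ) ^ 2 ≤ 1 / (sqDist e a z + δ) := by
    rw [div_le_div_iff₀ (by positivity) hpos]
    nlinarith [sq_inner_le_sqDist e a z i]
  have hfactor : hardyFieldDeriv e a c δ i z =
      c * (1 / (sqDist e a z + δ) - 2 * (inner ℝ (e i) (z - a) ^ 2 / (sqDist e a z + δ) ^ 2)) := by
    rw [hardyFieldDeriv]; ring
  have hnonneg : 0 ≤ inner ℝ (e i) (z - a) ^ 2 / (sqDist e a z + δ) ^ 2 := by positivity
  rw [hfactor, abs_mul]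
  gcongr
  rw [show 3 / δ = 3 * (1 / δ) by ring, abs_le]
  constructor <;> linarith

lemma sum_hardyFieldDeriv (e : ι → V) (a : V) (c δ : ℝ) (z : V) :
    ∑ i, hardyFieldDeriv e a c δ i z =
      Fintype.card ι * c / (sqDist e a z + δ) - 2 * c * sqDist e a z / (sqDist e a z + δ) ^ 2 := by
  simp only [hardyFieldDeriv, Finset.sum_sub_distrib, ← Finset.sum_div, ← Finset.mul_sum,
    Finset.sum_const, Finset.card_univ, nsmul_eq_mul, mul_div_assoc]
  rfl

lemma sum_hardyField_sq (e : ι → V) (a : V) (c δ : ℝ) (z : V) :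
    ∑ i, hardyField e a c δ i z ^ 2 = c ^ 2 * sqDist e a z / (sqDist e a z + δ) ^ 2 := by
  simp only [hardyField, div_pow, mul_pow, ← Finset.sum_div, ← Finset.mul_sum]
  rfl

/- With `m = 2 c + 2` the two sides differ by `c (c + 2) δ / (|x|² + δ)²`. -/
lemma sq_div_le_sum_hardyFieldDeriv_sub_sq (e : ι → V) (a : V) {c : ℝ} (hc : 0 ≤ c)
    (hcard : (Fintype.card ι : ℝ) = 2 * c + 2) (hδ : 0 < δ) (z : V) :
    c ^ 2 / (sqDist e a z + δ) ≤
      ∑ i, (hardyFieldDeriv e a c δ i z - hardyField e a c δ i z ^ 2) := by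
  have hpos := sqDist_add_pos e a hδ z
  rw [Finset.sum_sub_distrib, sum_hardyFieldDeriv, sum_hardyField_sq, hcard, ← sub_nonneg]
  have hdiff : (2 * c + 2) * c / (sqDist e a z + δ)
      - 2 * c * sqDist e a z / (sqDist e a z + δ) ^ 2
      - c ^ 2 * sqDist e a z / (sqDist e a z + δ) ^ 2 - c ^ 2 / (sqDist e a z + δ)
      = c * (c + 2) * δ / (sqDist e a z + δ) ^ 2 := by
    field_simp
    ring
  rw [hdiff]
  positivity

variable [FiniteDimensional ℝ V] [MeasurableSpace V] [BorelSpace V]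
  {F : Type*} [NormedAddCommGroup F] [InnerProductSpace ℝ F]

theorem hardy_inequality {e : ι → V} (he : Orthonormal ℝ e) (a : V) (hδ : 0 < δ)
    (hm : 2 ≤ Fintype.card ι) (g : 𝓢(V, F)) :
    (((Fintype.card ι : ℝ) - 2) / 2) ^ 2 * ∫ z, ‖g z‖ ^ 2 / (sqDist e a z + δ)
      ≤ ∑ i, ∫ z, ‖∂_{e i} g z‖ ^ 2 := by
  set c : ℝ := ((Fintype.card ι : ℝ) - 2) / 2 with hc
  have hm' : (2 : ℝ) ≤ Fintype.card ι := by exact_mod_cast hm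
  have hX := continuous_hardyField e a c hδ
  have hX' := continuous_hardyFieldDeriv e a c hδ
  have hint : ∀ i, Integrable fun z =>
      (hardyFieldDeriv e a c δ i z - hardyField e a c δ i z ^ 2) * ‖g z‖ ^ 2 := fun i => by
    refine (integrable_norm_sq_schwartz g).bdd_mul
      (c := |c| * (3 / δ) + (|c| * (1 + 1 / δ)) ^ 2)
      ((hX' i).sub ((hX i).pow 2)).aestronglyMeasurable (.of_forall fun z => ?_)
    refine (norm_sub_le _ _).trans (add_le_add (abs_hardyFieldDeriv_le e a c hδ i z) ?_)
    rw [norm_pow]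
    exact pow_le_pow_left₀ (norm_nonneg _) (abs_hardyField_le e a c hδ i z) 2
  calc c ^ 2 * ∫ z, ‖g z‖ ^ 2 / (sqDist e a z + δ)
      = ∫ z, c ^ 2 / (sqDist e a z + δ) * ‖g z‖ ^ 2 := by
        rw [← integral_const_mul]
        congr with z
        ring
    _ ≤ ∫ z, ∑ i, (hardyFieldDeriv e a c δ i z - hardyField e a c δ i z ^ 2) * ‖g z‖ ^ 2 := by
        refine integral_mono_of_nonneg (.of_forall fun z => ?_)
          (integrable_finsetSum _ fun i _ => hint i) (.of_forall fun z => ?_)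
        · have := sqDist_add_pos e a hδ z
          positivity
        · simp only [← Finset.sum_mul]
          gcongr
          exact sq_div_le_sum_hardyFieldDeriv_sub_sq e a (by rw [hc]; linarith)
            (by rw [hc]; ring) hδ z
    _ = ∑ i, ∫ z, (hardyFieldDeriv e a c δ i z - hardyField e a c δ i z ^ 2) * ‖g z‖ ^ 2 :=
        integral_finsetSum _ fun i _ => hint i
    _ ≤ ∑ i, ∫ z, ‖∂_{e i} g z‖ ^ 2 := Finset.sum_le_sum fun i _ =>
        integral_deriv_sub_sq_mul_norm_sq_le (hasLineDerivAt_hardyField he a c hδ i)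
          (hX i).aestronglyMeasurable (abs_hardyField_le e a c hδ i)
          (hX' i).aestronglyMeasurable (abs_hardyFieldDeriv_le e a c hδ i) g

end Hardy

section DirichletEnergy

variable {V : Type*} [NormedAddCommGroup V] [InnerProductSpace ℝ V] [FiniteDimensional ℝ V]
  [MeasurableSpace V] [BorelSpace V] {ι : Type*} [Fintype ι]

lemma integral_norm_sq_lineDeriv_fourier (e : V) (h : 𝓢(V, ℂ)) :
    ∫ x, ‖∂_{e} (𝓕 h) x‖ ^ 2 = 4 * Real.pi ^ 2 * ∫ x, inner ℝ e x ^ 2 * ‖h x‖ ^ 2 := by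
  rw [SchwartzMap.lineDerivOp_fourier_eq, SchwartzMap.integral_norm_sq_fourier,
    ← integral_const_mul]
  congr with x
  rw [smul_apply, SchwartzMap.smulLeftCLM_apply_apply (by fun_prop), norm_smul, norm_smul,
    mul_pow, mul_pow, real_inner_comm, Real.norm_eq_abs, sq_abs]
  simp only [norm_neg, norm_mul, mul_pow, Complex.norm_I, Complex.norm_real, Complex.norm_ofNat,
    Real.norm_eq_abs, sq_abs]
  ring

lemma memLp_norm_mul_schwartz (h : 𝓢(V, ℂ)) : MemLp (fun x => (‖x‖ : ℂ) * h x) 2 := by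
  have hgrowth : (fun x : V => (1 + ‖x‖ ^ 2 : ℝ)).HasTemperateGrowth := by fun_prop
  refine ((SchwartzMap.smulLeftCLM ℂ (fun x : V => (1 + ‖x‖ ^ 2 : ℝ)) h).memLp 2).mono
    (by fun_prop : Continuous fun x => (‖x‖ : ℂ) * h x).aestronglyMeasurable
    (.of_forall fun x => ?_)
  rw [SchwartzMap.smulLeftCLM_apply_apply hgrowth, norm_smul, norm_mul, Complex.norm_real,
    norm_norm, Real.norm_of_nonneg (by positivity)]
  gcongr
  nlinarith [sq_nonneg (‖x‖ - 1)]

lemma integrable_norm_sq_mul_norm_sq_schwartz (h : 𝓢(V, ℂ)) :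
    Integrable fun x => ‖x‖ ^ 2 * ‖h x‖ ^ 2 := by
  simpa [mul_pow] using (memLp_norm_mul_schwartz h).integrable_norm_pow two_ne_zero

lemma sum_integral_norm_sq_lineDeriv_fourier (e : ι → V) (h : 𝓢(V, ℂ)) :
    ∑ i, ∫ x, ‖∂_{e i} (𝓕 h) x‖ ^ 2
      = 4 * Real.pi ^ 2 * ∫ x, (∑ i, inner ℝ (e i) x ^ 2) * ‖h x‖ ^ 2 := by
  have hint : ∀ i, Integrable fun x => inner ℝ (e i) x ^ 2 * ‖h x‖ ^ 2 := fun i => by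
    refine ((integrable_norm_sq_mul_norm_sq_schwartz h).const_mul (‖e i‖ ^ 2)).mono'
      (Continuous.aestronglyMeasurable (by fun_prop)) (.of_forall fun x => ?_)
    rw [Real.norm_of_nonneg (by positivity), ← mul_assoc, ← mul_pow ‖e i‖,
      ← sq_abs (inner ℝ (e i) x)]
    gcongr
    exact abs_real_inner_le_norm (e i) x
  simp only [integral_norm_sq_lineDeriv_fourier, ← Finset.mul_sum, Finset.sum_mul]
  rw [integral_finsetSum _ fun i _ => hint i]

/-- The Dirichlet energy `∫ |∇g|²`, where `|∇g|` is the Hilbert–Schmidt norm of the derivative. -/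
noncomputable def dirichletEnergy (g : 𝓢(V, ℂ)) : ℝ :=
  ∑ i, ∫ z, ‖∂_{stdOrthonormalBasis ℝ V i} g z‖ ^ 2

lemma dirichletEnergy_fourier (h : 𝓢(V, ℂ)) :
    dirichletEnergy (𝓕 h) = 4 * Real.pi ^ 2 * ∫ x, ‖x‖ ^ 2 * ‖h x‖ ^ 2 := by
  simp only [dirichletEnergy, sum_integral_norm_sq_lineDeriv_fourier,
    ← (stdOrthonormalBasis ℝ V).sum_sq_norm_inner_right, Real.norm_eq_abs, sq_abs]

lemma sum_integral_norm_sq_lineDeriv_le_dirichletEnergy {e : ι → V} (he : Orthonormal ℝ e)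
    (g : 𝓢(V, ℂ)) : ∑ i, ∫ z, ‖∂_{e i} g z‖ ^ 2 ≤ dirichletEnergy g := by
  obtain ⟨h, rfl⟩ : ∃ h, 𝓕 h = g := ⟨𝓕⁻ g, FourierTransform.fourier_fourierInv_eq g⟩
  rw [sum_integral_norm_sq_lineDeriv_fourier, dirichletEnergy_fourier]
  gcongr ?_ * ?_
  refine integral_mono_of_nonneg (.of_forall fun x => by positivity)
    (integrable_norm_sq_mul_norm_sq_schwartz h) (.of_forall fun x => ?_)
  simp only
  gcongr
  simpa [sq_abs] using he.sum_inner_products_le (s := Finset.univ) x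

end DirichletEnergy

section HardyWeight

variable {V : Type*} [NormedAddCommGroup V] [InnerProductSpace ℝ V] [FiniteDimensional ℝ V]

lemma infDist_sq_eq_sqDist (H : AffineSubspace ℝ V) {a : V} (ha : a ∈ H) {ι : Type*} [Fintype ι]
    (b : OrthonormalBasis ι ℝ H.directionᗮ) (z : V) :
    Metric.infDist z (H : Set V) ^ 2 = sqDist (fun i => (b i : V)) a z := by
  have : Nonempty H := ⟨⟨a, ha⟩⟩
  set p : V := (EuclideanGeometry.orthogonalProjection H z).1 with hp
  have hzp : z - p ∈ H.directionᗮ := by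
    simpa [hp] using EuclideanGeometry.vsub_orthogonalProjection_mem_direction_orthogonal H z
  have hpa : p - a ∈ H.direction :=
    AffineSubspace.vsub_mem_direction (EuclideanGeometry.orthogonalProjection_mem (s := H) z) ha
  have hinner : ∀ i, inner ℝ (b i : V) (z - a) = inner ℝ (b i : V) (z - p) := fun i => by
    rw [← sub_add_sub_cancel z p a, inner_add_right,
      Submodule.inner_left_of_mem_orthogonal hpa (b i).2, add_zero]
  calc Metric.infDist z (H : Set V) ^ 2 = ‖(⟨z - p, hzp⟩ : H.directionᗮ)‖ ^ 2 := by
        rw [← EuclideanGeometry.dist_orthogonalProjection_eq_infDist, dist_eq_norm,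
          Submodule.coe_norm]
    _ = sqDist (fun i => (b i : V)) a z := by
        simp only [← b.sum_sq_norm_inner_right, Submodule.coe_inner, Real.norm_eq_abs, sq_abs,
          sqDist, hinner]

variable [MeasurableSpace V] [BorelSpace V]

/-- The Hardy inequality `∫ |g|² / w ≤ C ∫ |∇g|²` with weight `w` and constant `C`. The weight is
regularized to `w + δ` because where `|g|² / w` is not integrable its integral would be `0`. -/
structure IsHardyWeight (w : V → ℝ) (C : ℝ) : Prop where
  measurable : Measurable w
  nonneg : ∀ z, 0 ≤ w z
  const_nonneg : 0 ≤ C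
  integral_le : ∀ (g : 𝓢(V, ℂ)) (δ : ℝ), 0 < δ →
    ∫ z, ‖g z‖ ^ 2 / (w z + δ) ≤ C * dirichletEnergy g

lemma isHardyWeight_sqDist {ι : Type*} [Fintype ι] {e : ι → V} (he : Orthonormal ℝ e) (a : V)
    (hm : 2 < Fintype.card ι) :
    IsHardyWeight (sqDist e a) (4 / ((Fintype.card ι : ℝ) - 2) ^ 2) where
  measurable := (continuous_sqDist e a).measurable
  nonneg := sqDist_nonneg e a
  const_nonneg := by positivity
  integral_le g δ hδ := by
    have hm' : (2 : ℝ) < Fintype.card ι := by exact_mod_cast hm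
    have hpos : (0 : ℝ) < (Fintype.card ι - 2) ^ 2 := by
      have := sub_pos.2 hm'
      positivity
    have hle := (hardy_inequality he a hδ hm.le g).trans
      (sum_integral_norm_sq_lineDeriv_le_dirichletEnergy he g)
    rw [div_mul_eq_mul_div, le_div_iff₀ hpos]
    linarith

theorem isHardyWeight_infDist_sq {H : AffineSubspace ℝ V} (hne : (H : Set V).Nonempty) {m : ℕ}
    (hcodim : Module.finrank ℝ (V ⧸ H.direction) = m) (hm : 3 ≤ m) :
    IsHardyWeight (fun z => Metric.infDist z (H : Set V) ^ 2) (4 / ((m : ℝ) - 2) ^ 2) := by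
  obtain ⟨a, ha⟩ := hne
  let b := stdOrthonormalBasis ℝ H.directionᗮ
  have hcard : Fintype.card (Fin (Module.finrank ℝ H.directionᗮ)) = m := by
    have horth := Submodule.finrank_add_finrank_orthogonal H.direction
    have hquot := Submodule.finrank_quotient_add_finrank H.direction
    rw [Fintype.card_fin]
    omega
  have he : Orthonormal ℝ fun i => (b i : V) :=
    b.orthonormal.comp_linearIsometry H.directionᗮ.subtypeₗᵢ
  have hw := isHardyWeight_sqDist he a (by omega)
  rw [hcard] at hw
  simpa only [infDist_sq_eq_sqDist H ha b] using hw

end HardyWeight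

section Duality

lemma exists_inner_eq_of_norm_le {𝕜 M E : Type*} [RCLike 𝕜] [AddCommGroup M] [Module 𝕜 M]
    [NormedAddCommGroup E] [InnerProductSpace 𝕜 E] [CompleteSpace E] (T : M →ₗ[𝕜] E)
    (l : M →ₗ[𝕜] 𝕜) {C : ℝ} (hC : 0 ≤ C) (h : ∀ x, ‖l x‖ ≤ C * ‖T x‖) :
    ∃ F : E, ‖F‖ ≤ C ∧ ∀ x, l x = inner 𝕜 F (T x) := by
  have hl : ∀ x, l.compLeftInverse T ⟨T x, x, rfl⟩ = l x := fun x =>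
    LinearMap.compLeftInverse_apply_of_bdd l T ⟨C, h⟩ x (T x) rfl
  obtain ⟨g, hgl, hgnorm⟩ := exists_extension_norm_eq _ (l.compLeftInverse T)
  refine ⟨(InnerProductSpace.toDual 𝕜 E).symm g, ?_, fun x => ?_⟩
  · rw [LinearIsometryEquiv.norm_map, hgnorm]
    refine ContinuousLinearMap.opNorm_le_bound _ hC ?_
    rintro ⟨_, x, rfl⟩
    rw [hl]
    exact h x
  · rw [InnerProductSpace.toDual_symm_apply]
    exact ((hgl ⟨T x, x, rfl⟩).trans (hl x)).symm

section MeasureSpace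

variable {α 𝕜 : Type*} [MeasurableSpace α] {μ : Measure α} [RCLike 𝕜]

lemma sq_norm_integral_mul_le_of_weight {f g : α → 𝕜} {w : α → ℝ} (hw : AEMeasurable w μ)
    (hw0 : ∀ x, 0 < w x) (hf : AEStronglyMeasurable f μ) (hg : AEStronglyMeasurable g μ)
    (hfw : Integrable (fun x => ‖f x‖ ^ 2 * w x) μ)
    (hgw : Integrable (fun x => ‖g x‖ ^ 2 / w x) μ) :
    ‖∫ x, f x * g x ∂μ‖ ^ 2 ≤ (∫ x, ‖f x‖ ^ 2 * w x ∂μ) * ∫ x, ‖g x‖ ^ 2 / w x ∂μ := by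
  have hf_sq : ∀ x, (‖f x‖ * √(w x)) ^ 2 = ‖f x‖ ^ 2 * w x := fun x => by
    rw [mul_pow, Real.sq_sqrt (hw0 x).le]
  have hg_sq : ∀ x, (‖g x‖ / √(w x)) ^ 2 = ‖g x‖ ^ 2 / w x := fun x => by
    rw [div_pow, Real.sq_sqrt (hw0 x).le]
  have hf_memLp : MemLp (fun x => ‖f x‖ * √(w x)) 2 μ := by
    refine (memLp_two_iff_integrable_sq
      (hf.norm.aemeasurable.mul hw.sqrt).aestronglyMeasurable).2 ?_
    simpa only [Pi.mul_apply, hf_sq] using hfw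
  have hg_memLp : MemLp (fun x => ‖g x‖ / √(w x)) 2 μ := by
    refine (memLp_two_iff_integrable_sq
      (hg.norm.aemeasurable.div hw.sqrt).aestronglyMeasurable).2 ?_
    simpa only [Pi.div_apply, hg_sq] using hgw
  have hle : ‖∫ x, f x * g x ∂μ‖ ≤ ∫ x, ‖f x‖ * √(w x) * (‖g x‖ / √(w x)) ∂μ := by
    refine (norm_integral_le_integral_norm _).trans_eq ?_
    congr with x
    have := (Real.sqrt_pos.2 (hw0 x)).ne'
    rw [norm_mul]
    field_simp
  have hholder := integral_mul_le_Lp_mul_Lq_of_nonneg (μ := μ) Real.HolderConjugate.two_two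
    (f := fun x => ‖f x‖ * √(w x)) (g := fun x => ‖g x‖ / √(w x))
    (.of_forall fun x => by positivity) (.of_forall fun x => by positivity)
    (by simpa using hf_memLp) (by simpa using hg_memLp)
  simp only [Real.rpow_two, hf_sq, hg_sq, ← Real.sqrt_eq_rpow] at hholder
  calc _ ≤ (√(∫ x, ‖f x‖ ^ 2 * w x ∂μ) * √(∫ x, ‖g x‖ ^ 2 / w x ∂μ)) ^ 2 :=
        pow_le_pow_left₀ (norm_nonneg _) (hle.trans hholder) 2
    _ = _ := by
        rw [mul_pow, Real.sq_sqrt, Real.sq_sqrt]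
        · exact integral_nonneg fun x => div_nonneg (sq_nonneg _) (hw0 x).le
        · exact integral_nonneg fun x => mul_nonneg (sq_nonneg _) (hw0 x).le

lemma norm_sq_eq_integral_norm_sq {E : Type*} [NormedAddCommGroup E] [InnerProductSpace ℝ E]
    (f : Lp E 2 μ) : ‖f‖ ^ 2 = ∫ x, ‖f x‖ ^ 2 ∂μ := by
  rw [← real_inner_self_eq_norm_sq, L2.inner_def]
  simp only [real_inner_self_eq_norm_sq]

lemma norm_star_Lp {p : ENNReal} (f : Lp 𝕜 p μ) : ‖star f‖ = ‖f‖ := by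
  rw [Lp.norm_def, Lp.norm_def]
  refine congrArg _ (eLpNorm_congr_norm_ae ?_)
  filter_upwards [Lp.coeFn_star f] with x hx
  rw [hx, Pi.star_apply, norm_star]

lemma norm_sq_toLp_eq_integral_norm_sq {E : Type*} [NormedAddCommGroup E] [InnerProductSpace ℝ E]
    {f : α → E} (hf : MemLp f 2 μ) : ‖hf.toLp f‖ ^ 2 = ∫ x, ‖f x‖ ^ 2 ∂μ := by
  rw [norm_sq_eq_integral_norm_sq]
  exact integral_congr_ae (hf.coeFn_toLp.mono fun x hx => by simp only [hx])

end MeasureSpace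

variable {V : Type*} [NormedAddCommGroup V] [InnerProductSpace ℝ V] [FiniteDimensional ℝ V]
  [MeasurableSpace V] [BorelSpace V]

lemma ae_eq_of_forall_integral_schwartz_mul_eq {f g : V → ℂ} (hf : LocallyIntegrable f)
    (hg : LocallyIntegrable g) (h : ∀ ψ : 𝓢(V, ℂ), ∫ x, ψ x * f x = ∫ x, ψ x * g x) :
    f =ᵐ[volume] g := by
  refine ae_eq_of_integral_contDiff_smul_eq hf hg fun φ hφ hφc => ?_
  have hsmooth : ContDiff ℝ (⊤ : ℕ∞) (Complex.ofRealCLM ∘ φ) := by fun_prop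
  have hsupp : HasCompactSupport (Complex.ofRealCLM ∘ φ) := hφc.comp_left rfl
  simp only [Complex.real_smul]
  exact h (hsupp.toSchwartzMap hsmooth)

lemma locallyIntegrable_continuous_mul {c f : V → ℂ} (hc : Continuous c)
    (hf : LocallyIntegrable f) : LocallyIntegrable fun x => c x * f x := by
  rw [← locallyIntegrableOn_univ] at hf ⊢
  exact hf.continuousOn_mul hc.continuousOn isOpen_univ.isLocallyClosed

/-- The Fourier transform of a square integrable function. -/
noncomputable def fourierL2 {f : V → ℂ} (hf : MemLp f 2 volume) : Lp (α := V) ℂ 2 volume :=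
  𝓕 (hf.toLp f : Lp (α := V) ℂ 2 volume)

lemma integral_mul_fourier_eq {f : V → ℂ} (hf : MemLp f 2 volume) (h : 𝓢(V, ℂ)) :
    ∫ z, f z * 𝓕 h z = ∫ x, h x * fourierL2 hf x := by
  have htranspose := congr($(Lp.fourier_toTemperedDistribution_eq (hf.toLp f)) h)
  rw [TemperedDistribution.fourier_apply] at htranspose
  refine Eq.trans (integral_congr_ae ?_) (by simpa [fourierL2] using htranspose)
  filter_upwards [hf.coeFn_toLp] with x hx
  rw [hx, mul_comm]

lemma norm_fourierL2_sq {f : V → ℂ} (hf : MemLp f 2 volume) :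
    ‖fourierL2 hf‖ ^ 2 = ∫ z, ‖f z‖ ^ 2 := by
  rw [fourierL2, Lp.norm_fourier_eq, norm_sq_toLp_eq_integral_norm_sq]

lemma exists_fourierL2_eq (F : Lp (α := V) ℂ 2 volume) :
    ∃ (f : V → ℂ) (hf : MemLp f 2 volume), fourierL2 hf = F :=
  ⟨(𝓕⁻ F : Lp (α := V) ℂ 2 volume), Lp.memLp _, by
    rw [fourierL2, Lp.toLp_coeFn]; exact FourierTransform.fourier_fourierInv_eq F⟩

/-- Multiplication by `‖x‖`, as a linear map from Schwartz functions to `L²`. -/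
noncomputable def normMulLp : 𝓢(V, ℂ) →ₗ[ℂ] Lp (α := V) ℂ 2 volume where
  toFun h := (memLp_norm_mul_schwartz h).toLp _
  map_add' h k := by
    rw [← MemLp.toLp_add]
    exact MemLp.toLp_congr _ _ (.of_forall fun x => by simp [mul_add])
  map_smul' c h := by
    rw [RingHom.id_apply, ← MemLp.toLp_const_smul]
    exact MemLp.toLp_congr _ _ (.of_forall fun x => by simp [mul_left_comm])

lemma coeFn_normMulLp (h : 𝓢(V, ℂ)) : normMulLp h =ᵐ[volume] fun x => (‖x‖ : ℂ) * h x :=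
  (memLp_norm_mul_schwartz h).coeFn_toLp

lemma dirichletEnergy_fourier_eq_norm_normMulLp (h : 𝓢(V, ℂ)) :
    dirichletEnergy (𝓕 h) = 4 * Real.pi ^ 2 * ‖normMulLp h‖ ^ 2 := by
  rw [dirichletEnergy_fourier, normMulLp, LinearMap.coe_mk, AddHom.coe_mk,
    norm_sq_toLp_eq_integral_norm_sq]
  simp [mul_pow]

/-- Integration of the Fourier transform of a Schwartz function against an `L²` function. -/
noncomputable def fourierPairing {f : V → ℂ} (hf : MemLp f 2 volume) : 𝓢(V, ℂ) →ₗ[ℂ] ℂ where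
  toFun h := ∫ x, f x * 𝓕 h x
  map_add' h k := by
    have hint : ∀ h : 𝓢(V, ℂ), Integrable fun x => f x * 𝓕 h x := fun h =>
      hf.integrable_mul ((𝓕 h).memLp 2)
    rw [← integral_add (hint h) (hint k)]
    simp only [FourierTransform.fourier_add, add_apply, mul_add]
  map_smul' c h := by
    rw [RingHom.id_apply, smul_eq_mul, ← integral_const_mul]
    simp only [FourierTransform.fourier_smul, smul_apply, smul_eq_mul, mul_left_comm]

/- The bound makes `h ↦ ∫ f̂ h` a bounded functional of `‖x‖ h` in `L²`; `F̄` is its Riesz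
representative. -/
theorem exists_fourierL2_eq_norm_mul_of_bound {f : V → ℂ} (hf : MemLp f 2 volume) {C : ℝ}
    (hC : 0 ≤ C) (hbound : ∀ h : 𝓢(V, ℂ), ‖∫ z, f z * 𝓕 h z‖ ≤ C * ‖normMulLp h‖) :
    ∃ F : Lp (α := V) ℂ 2 volume, ‖F‖ ≤ C ∧ ∀ᵐ x, fourierL2 hf x = ‖x‖ * F x := by
  obtain ⟨G, hGnorm, hG⟩ := exists_inner_eq_of_norm_le normMulLp (fourierPairing hf) hC hbound
  refine ⟨star G, (norm_star_Lp G).trans_le hGnorm, ?_⟩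
  refine ae_eq_of_forall_integral_schwartz_mul_eq
    ((Lp.memLp _).locallyIntegrable one_le_two)
    (locallyIntegrable_continuous_mul (by fun_prop)
      ((Lp.memLp _).locallyIntegrable one_le_two)) fun h => ?_
  calc ∫ x, h x * fourierL2 hf x = inner ℂ G (normMulLp h) := by
        rw [← integral_mul_fourier_eq]; exact hG h
    _ = ∫ x, h x * (‖x‖ * (star G : Lp (α := V) ℂ 2 volume) x) := by
        rw [L2.inner_def]
        refine integral_congr_ae ?_
        filter_upwards [coeFn_normMulLp h, Lp.coeFn_star G] with x hx hGx
        rw [hx, hGx, RCLike.inner_apply, Pi.star_apply, RCLike.star_def]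
        ring

lemma IsHardyWeight.sq_norm_integral_mul_le {w : V → ℝ} {C : ℝ} (hw : IsHardyWeight w C)
    {f : V → ℂ} (hf : MemLp f 2 volume) (hfw : Integrable fun z => ‖f z‖ ^ 2 * w z)
    (g : 𝓢(V, ℂ)) :
    ‖∫ z, f z * g z‖ ^ 2 ≤ (∫ z, ‖f z‖ ^ 2 * w z) * (C * dirichletEnergy g) := by
  have hf_sq : Integrable fun z => ‖f z‖ ^ 2 := hf.integrable_norm_pow two_ne_zero
  have hle : ∀ δ : ℝ, 0 < δ → ‖∫ z, f z * g z‖ ^ 2 ≤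
      ((∫ z, ‖f z‖ ^ 2 * w z) + δ * ∫ z, ‖f z‖ ^ 2) * (C * dirichletEnergy g) := by
    intro δ hδ
    have hpos : ∀ z, 0 < w z + δ := fun z => add_pos_of_nonneg_of_pos (hw.nonneg z) hδ
    have hm := hw.measurable.add_const δ
    have hfδ : Integrable fun z => ‖f z‖ ^ 2 * (w z + δ) := by
      simp only [mul_add]
      exact hfw.add (hf_sq.mul_const δ)
    have hgδ : Integrable fun z => ‖g z‖ ^ 2 / (w z + δ) := by
      simp only [div_eq_mul_inv]
      refine (integrable_norm_sq_schwartz g).mul_bdd (c := δ⁻¹) hm.inv.aestronglyMeasurable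
        (.of_forall fun z => ?_)
      rw [norm_inv, Real.norm_of_nonneg (hpos z).le]
      exact inv_anti₀ hδ (le_add_of_nonneg_left (hw.nonneg z))
    calc ‖∫ z, f z * g z‖ ^ 2
        ≤ (∫ z, ‖f z‖ ^ 2 * (w z + δ)) * ∫ z, ‖g z‖ ^ 2 / (w z + δ) :=
          sq_norm_integral_mul_le_of_weight hm.aemeasurable hpos hf.1
            g.continuous.aestronglyMeasurable hfδ hgδ
      _ ≤ (∫ z, ‖f z‖ ^ 2 * (w z + δ)) * (C * dirichletEnergy g) :=
          mul_le_mul_of_nonneg_left (hw.integral_le g δ hδ)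
            (integral_nonneg fun z => mul_nonneg (sq_nonneg _) (hpos z).le)
      _ = _ := by
          simp only [mul_add]
          rw [integral_add hfw (hf_sq.mul_const δ), integral_mul_const, mul_comm δ]
  have hlim : Tendsto (fun δ : ℝ =>
      ((∫ z, ‖f z‖ ^ 2 * w z) + δ * ∫ z, ‖f z‖ ^ 2) * (C * dirichletEnergy g)) (𝓝[>] 0)
      (𝓝 (((∫ z, ‖f z‖ ^ 2 * w z) + 0 * ∫ z, ‖f z‖ ^ 2) * (C * dirichletEnergy g))) :=
    (Continuous.tendsto (by fun_prop) 0).mono_left nhdsWithin_le_nhds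
  simpa using ge_of_tendsto hlim (eventually_nhdsWithin_of_forall hle)

theorem IsHardyWeight.exists_fourierL2_eq_norm_mul {w : V → ℝ} {C : ℝ} (hw : IsHardyWeight w C)
    {f : V → ℂ} (hf : MemLp f 2 volume) (hfw : Integrable fun z => ‖f z‖ ^ 2 * w z) :
    ∃ F : Lp (α := V) ℂ 2 volume, ‖F‖ ^ 2 ≤ 4 * Real.pi ^ 2 * C * ∫ z, ‖f z‖ ^ 2 * w z ∧
      ∀ᵐ x, fourierL2 hf x = ‖x‖ * F x := by
  set A : ℝ := 4 * Real.pi ^ 2 * C * ∫ z, ‖f z‖ ^ 2 * w z with hA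
  have hA0 : 0 ≤ A := mul_nonneg (mul_nonneg (by positivity) hw.const_nonneg)
    (integral_nonneg fun z => mul_nonneg (sq_nonneg _) (hw.nonneg z))
  have hbound : ∀ h : 𝓢(V, ℂ), ‖∫ z, f z * 𝓕 h z‖ ≤ √A * ‖normMulLp h‖ := fun h => by
    refine le_of_sq_le_sq ?_ (by positivity)
    rw [mul_pow, Real.sq_sqrt hA0]
    refine (hw.sq_norm_integral_mul_le hf hfw (𝓕 h)).trans_eq ?_
    rw [dirichletEnergy_fourier_eq_norm_normMulLp, hA]
    ring
  obtain ⟨F, hF, hfF⟩ := exists_fourierL2_eq_norm_mul_of_bound hf (Real.sqrt_nonneg A) hbound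
  exact ⟨F, (Real.le_sqrt (norm_nonneg F) hA0).1 hF, hfF⟩

end Duality

section Truncation

variable {V : Type*} [NormedAddCommGroup V] [InnerProductSpace ℝ V] [FiniteDimensional ℝ V]

variable (V) in
/-- A smooth cutoff at scale one: equal to `1` on the unit ball and supported in the ball of
radius `2`. -/
noncomputable def unitCutoff : ContDiffBump (0 : V) := ⟨1, 2, one_pos, one_lt_two⟩

lemma contDiff_unitCutoff : ContDiff ℝ (⊤ : ℕ∞) (unitCutoff V) := (unitCutoff V).contDiff

/-- The smooth truncation of a Schwartz function to a ball of radius `2 (k + 1)`. -/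
noncomputable def truncate (ψ : 𝓢(V, ℂ)) (k : ℕ) (z : V) : ℂ :=
  unitCutoff V (((k : ℝ) + 1)⁻¹ • z) • ψ z

lemma contDiff_truncate (ψ : 𝓢(V, ℂ)) (k : ℕ) : ContDiff ℝ (⊤ : ℕ∞) (truncate ψ k) :=
  (contDiff_unitCutoff.comp (contDiff_const_smul _)).smul (ψ.smooth ⊤)

lemma hasCompactSupport_truncate (ψ : 𝓢(V, ℂ)) (k : ℕ) : HasCompactSupport (truncate ψ k) :=
  ((unitCutoff V).hasCompactSupport.comp_smul (by positivity)).smul_right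

lemma eventually_truncate_eventuallyEq (ψ : 𝓢(V, ℂ)) (z : V) :
    ∀ᶠ k : ℕ in atTop, truncate ψ k =ᶠ[𝓝 z] ψ := by
  filter_upwards [eventually_ge_atTop ⌈‖z‖⌉₊] with k hk
  have hz : ‖z‖ < (k : ℝ) + 1 := by
    linarith [Nat.le_ceil ‖z‖, (Nat.cast_le (α := ℝ)).2 hk]
  filter_upwards [continuous_norm.continuousAt.eventually_lt continuousAt_const hz] with y hy
  have hone : unitCutoff V (((k : ℝ) + 1)⁻¹ • y) = 1 := by
    refine (unitCutoff V).one_of_mem_closedBall (mem_closedBall_zero_iff.2 ?_)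
    rw [norm_smul, norm_inv, Real.norm_of_nonneg (by positivity)]
    exact (inv_mul_lt_one₀ (by positivity)).2 hy |>.le
  rw [truncate, hone, one_smul]

lemma norm_truncate_le (ψ : 𝓢(V, ℂ)) (k : ℕ) (z : V) : ‖truncate ψ k z‖ ≤ ‖ψ z‖ := by
  rw [truncate, norm_smul, Real.norm_of_nonneg (unitCutoff V).nonneg]
  exact mul_le_of_le_one_left (norm_nonneg _) (unitCutoff V).le_one

lemma fderiv_truncate_apply (ψ : 𝓢(V, ℂ)) (k : ℕ) (z w : V) :
    fderiv ℝ (truncate ψ k) z w = unitCutoff V (((k : ℝ) + 1)⁻¹ • z) • fderiv ℝ ψ z w +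
      (((k : ℝ) + 1)⁻¹ * fderiv ℝ (unitCutoff V) (((k : ℝ) + 1)⁻¹ • z) w) • ψ z := by
  have hcutoff : HasFDerivAt (fun y => unitCutoff V (((k : ℝ) + 1)⁻¹ • y))
      ((fderiv ℝ (unitCutoff V) (((k : ℝ) + 1)⁻¹ • z)).comp
        (((k : ℝ) + 1)⁻¹ • ContinuousLinearMap.id ℝ V)) z :=
    (contDiff_unitCutoff.differentiable (by simp)).differentiableAt.hasFDerivAt.comp z
      ((hasFDerivAt_id z).const_smul _)
  have htruncate : HasFDerivAt (truncate ψ k) _ z := hcutoff.smul ψ.differentiableAt.hasFDerivAt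
  rw [htruncate.fderiv]
  simp

lemma exists_norm_fderiv_truncate_le (ψ : 𝓢(V, ℂ)) (w : V) :
    ∃ C : ℝ, ∀ k z, ‖fderiv ℝ (truncate ψ k) z w‖ ≤ ‖fderiv ℝ ψ z w‖ + C * ‖ψ z‖ := by
  obtain ⟨C, hC⟩ := ((unitCutoff V).hasCompactSupport.fderiv (𝕜 := ℝ)).exists_bound_of_continuous
    (contDiff_unitCutoff.continuous_fderiv (by simp))
  refine ⟨C * ‖w‖, fun k z => ?_⟩
  have hscale : ((k : ℝ) + 1)⁻¹ ≤ 1 := inv_le_one_of_one_le₀ (by simp)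
  rw [fderiv_truncate_apply]
  refine (norm_add_le _ _).trans (add_le_add ?_ ?_)
  · rw [norm_smul, Real.norm_of_nonneg (unitCutoff V).nonneg]
    exact mul_le_of_le_one_left (norm_nonneg _) (unitCutoff V).le_one
  · rw [norm_smul, norm_mul, norm_inv, Real.norm_of_nonneg (by positivity)]
    refine mul_le_mul_of_nonneg_right ?_ (norm_nonneg _)
    calc ((k : ℝ) + 1)⁻¹ * ‖fderiv ℝ (unitCutoff V) (((k : ℝ) + 1)⁻¹ • z) w‖
        ≤ 1 * (‖fderiv ℝ (unitCutoff V) (((k : ℝ) + 1)⁻¹ • z)‖ * ‖w‖) := by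
          gcongr
          exact ContinuousLinearMap.le_opNorm _ _
      _ ≤ C * ‖w‖ := by
          rw [one_mul]
          exact mul_le_mul_of_nonneg_right (hC _) (norm_nonneg _)

variable [MeasurableSpace V] [BorelSpace V]

lemma memLp_fderiv_schwartz (ψ : 𝓢(V, ℂ)) (w : V) :
    MemLp (fun z => fderiv ℝ ψ z w) 2 volume :=
  MemLp.ae_eq (.of_forall fun z => SchwartzMap.lineDerivOp_apply_eq_fderiv w ψ z)
    ((∂_{w} ψ).memLp 2)

lemma tendsto_integral_mul_truncate {f : V → ℂ} (hf : MemLp f 2 volume) (ψ : 𝓢(V, ℂ)) :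
    Tendsto (fun k => ∫ z, f z * truncate ψ k z) atTop (𝓝 (∫ z, f z * ψ z)) := by
  refine tendsto_integral_of_dominated_convergence (fun z => ‖f z‖ * ‖ψ z‖)
    (fun k => hf.1.mul (contDiff_truncate ψ k).continuous.aestronglyMeasurable)
    (hf.norm.integrable_mul (ψ.memLp 2).norm) (fun k => .of_forall fun z => ?_)
    (.of_forall fun z => tendsto_const_nhds.congr' ?_)
  · rw [norm_mul]
    exact mul_le_mul_of_nonneg_left (norm_truncate_le ψ k z) (norm_nonneg _)
  · filter_upwards [eventually_truncate_eventuallyEq ψ z] with k hk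
    rw [hk.eq_of_nhds]

lemma tendsto_integral_mul_fderiv_truncate {f : V → ℂ} (hf : MemLp f 2 volume) (ψ : 𝓢(V, ℂ))
    (w : V) : Tendsto (fun k => ∫ z, f z * fderiv ℝ (truncate ψ k) z w) atTop
      (𝓝 (∫ z, f z * fderiv ℝ ψ z w)) := by
  obtain ⟨C, hC⟩ := exists_norm_fderiv_truncate_le ψ w
  refine tendsto_integral_of_dominated_convergence
    (fun z => ‖f z‖ * (‖fderiv ℝ ψ z w‖ + C * ‖ψ z‖))
    (fun k => hf.1.mul (((contDiff_truncate ψ k).continuous_fderiv (by simp)).clm_apply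
      continuous_const).aestronglyMeasurable)
    (hf.norm.integrable_mul
      ((memLp_fderiv_schwartz ψ w).norm.add ((ψ.memLp 2).norm.const_mul C)))
    (fun k => .of_forall fun z => ?_) (.of_forall fun z => tendsto_const_nhds.congr' ?_)
  · rw [norm_mul]
    exact mul_le_mul_of_nonneg_left (hC k z) (norm_nonneg _)
  · filter_upwards [eventually_truncate_eventuallyEq ψ z] with k hk
    rw [hk.fderiv_eq]

end Truncation

section ExteriorAlgebra

open scoped ComplexConjugate

variable {n : ℕ}

lemma wedgeSign_insert {j k : Fin n} {K : Finset (Fin n)} (hk : k ∉ K) :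
    wedgeSign j (insert k K) = (if k < j then -1 else 1) * wedgeSign j K := by
  rw [wedgeSign, wedgeSign, Finset.filter_insert]
  split_ifs with h
  · rw [Finset.card_insert_of_notMem (by simp [hk]), pow_succ']
  · rw [one_mul]

lemma wedgeSign_insert_self (j : Fin n) (K : Finset (Fin n)) :
    wedgeSign j (insert j K) = wedgeSign j K := by
  simp [wedgeSign, Finset.filter_insert]

lemma wedgeSign_mul_self (j : Fin n) (K : Finset (Fin n)) :
    wedgeSign j K * wedgeSign j K = 1 := by
  rw [wedgeSign, ← mul_pow, neg_one_mul, neg_neg, one_pow]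

lemma conj_wedgeSign (j : Fin n) (K : Finset (Fin n)) :
    conj (wedgeSign j K) = wedgeSign j K := by
  simp [wedgeSign]

lemma wedgeSign_anticomm {j k : Fin n} {K : Finset (Fin n)} (hj : j ∈ K) (hk : k ∉ K) :
    wedgeSign j K * wedgeSign k (K.erase j) + wedgeSign k K * wedgeSign j (insert k K) = 0 := by
  have herase : wedgeSign k K = (if j < k then -1 else 1) * wedgeSign k (K.erase j) := by
    conv_lhs => rw [← Finset.insert_erase hj]
    exact wedgeSign_insert (Finset.notMem_erase j K)
  rw [herase, wedgeSign_insert hk]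
  rcases lt_or_gt_of_ne (ne_of_mem_of_not_mem hj hk) with h | h
  · rw [if_pos h, if_neg h.not_gt]; ring
  · rw [if_neg h.not_gt, if_pos h]; ring

/-- The coefficients of `(∑ ζ_j dz̄_j) ∧ a`, where `a` assigns to each set of indices the
coefficient of the corresponding monomial. -/
noncomputable def wedge (ζ : Cn n) (a : Finset (Fin n) → ℂ) (K : Finset (Fin n)) : ℂ :=
  ∑ j ∈ K, wedgeSign j K * ζ j * a (K.erase j)

/-- The coefficients of the contraction of `a` with `ζ`: the adjoint of `wedge ζ`. -/
noncomputable def contract (ζ : Cn n) (a : Finset (Fin n) → ℂ) (I : Finset (Fin n)) : ℂ :=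
  ∑ k ∈ Iᶜ, wedgeSign k I * conj (ζ k) * a (insert k I)

lemma wedge_smul (ζ : Cn n) (c : ℂ) (a : Finset (Fin n) → ℂ) :
    wedge ζ (c • a) = c • wedge ζ a := by
  ext K
  simp only [wedge, Pi.smul_apply, smul_eq_mul, Finset.mul_sum, mul_left_comm]

@[simp]
lemma wedge_zero (ζ : Cn n) : wedge ζ 0 = 0 := by
  ext K
  simp [wedge]

@[simp]
lemma contract_zero (ζ : Cn n) : contract ζ 0 = 0 := by
  ext I
  simp [contract]

lemma wedge_contract (ζ : Cn n) (a : Finset (Fin n) → ℂ) (K : Finset (Fin n)) :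
    wedge ζ (contract ζ a) K = (∑ j ∈ K, ζ j * conj (ζ j)) * a K +
      ∑ j ∈ K, ∑ k ∈ Kᶜ, wedgeSign j K * wedgeSign k (K.erase j) *
        (ζ j * conj (ζ k) * a (insert k (K.erase j))) := by
  unfold wedge contract
  rw [Finset.sum_mul, ← Finset.sum_add_distrib]
  refine Finset.sum_congr rfl fun j hj => ?_
  have hsign : wedgeSign j (K.erase j) = wedgeSign j K := by
    rw [← wedgeSign_insert_self j (K.erase j), Finset.insert_erase hj]
  rw [Finset.compl_erase, Finset.sum_insert (by simp [hj]), Finset.insert_erase hj, mul_add,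
    Finset.mul_sum, hsign]
  congr 1
  · linear_combination (ζ j * conj (ζ j) * a K) * wedgeSign_mul_self j K
  · exact Finset.sum_congr rfl fun k _ => by ring

lemma contract_wedge (ζ : Cn n) (a : Finset (Fin n) → ℂ) (K : Finset (Fin n)) :
    contract ζ (wedge ζ a) K = (∑ k ∈ Kᶜ, ζ k * conj (ζ k)) * a K +
      ∑ j ∈ K, ∑ k ∈ Kᶜ, wedgeSign k K * wedgeSign j (insert k K) *
        (ζ j * conj (ζ k) * a (insert k (K.erase j))) := by
  simp only [contract, wedge]
  rw [Finset.sum_comm (s := K), Finset.sum_mul, ← Finset.sum_add_distrib]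
  refine Finset.sum_congr rfl fun k hk => ?_
  rw [Finset.mem_compl] at hk
  rw [Finset.sum_insert hk, wedgeSign_insert_self, Finset.erase_insert hk, mul_add,
    Finset.mul_sum]
  congr 1
  · linear_combination (ζ k * conj (ζ k) * a K) * wedgeSign_mul_self k K
  · refine Finset.sum_congr rfl fun j hj => ?_
    rw [Finset.erase_insert_of_ne (ne_of_mem_of_not_mem hj hk).symm]
    ring

lemma wedge_contract_add_contract_wedge (ζ : Cn n) (a : Finset (Fin n) → ℂ) :
    wedge ζ (contract ζ a) + contract ζ (wedge ζ a) = ((‖ζ‖ ^ 2 : ℝ) : ℂ) • a := by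
  ext K
  have hnorm : ((‖ζ‖ ^ 2 : ℝ) : ℂ) = ∑ j, ζ j * conj (ζ j) := by
    simp [EuclideanSpace.norm_sq_eq, Complex.mul_conj']
  rw [Pi.add_apply, Pi.smul_apply, smul_eq_mul, hnorm, wedge_contract, contract_wedge,
    add_add_add_comm, ← add_mul, Finset.sum_add_sum_compl, add_eq_left,
    ← Finset.sum_add_distrib]
  refine Finset.sum_eq_zero fun j hj => ?_
  rw [← Finset.sum_add_distrib]
  refine Finset.sum_eq_zero fun k hk => ?_
  rw [← add_mul, wedgeSign_anticomm hj (Finset.mem_compl.1 hk), zero_mul]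

lemma sum_contract_mul_conj (ζ : Cn n) (a b : Finset (Fin n) → ℂ) :
    ∑ I, contract ζ a I * conj (b I) = ∑ K, a K * conj (wedge ζ b K) := by
  unfold contract wedge
  simp only [map_sum, Finset.mul_sum, Finset.sum_mul]
  rw [Finset.sum_sigma', Finset.sum_sigma']
  refine Finset.sum_bij' (fun p _ => ⟨insert p.2 p.1, p.2⟩) (fun p _ => ⟨p.1.erase p.2, p.2⟩)
    (by simp) (by simp) ?_ ?_ ?_
  · rintro ⟨I, k⟩ h
    have hk : k ∉ I := by simpa using h
    simp only [Finset.erase_insert hk]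
  · rintro ⟨K, k⟩ h
    have hk : k ∈ K := by simpa using h
    simp only [Finset.insert_erase hk]
  · rintro ⟨I, k⟩ h
    have hk : k ∉ I := by simpa using h
    simp only [Finset.erase_insert hk, map_mul, wedgeSign_insert_self, conj_wedgeSign]
    ring

/-- The solution `b` of `ζ ∧ b = a` of least norm, for `ζ ∧ a = 0` and `ζ ≠ 0`; it is `0` for
`ζ = 0`. -/
noncomputable def minimalSolution (ζ : Cn n) (a : Finset (Fin n) → ℂ) : Finset (Fin n) → ℂ :=
  ((‖ζ‖ ^ 2 : ℝ) : ℂ)⁻¹ • contract ζ a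

lemma wedge_minimalSolution {ζ : Cn n} {a : Finset (Fin n) → ℂ} (hclosed : wedge ζ a = 0)
    (hzero : ζ = 0 → a = 0) : wedge ζ (minimalSolution ζ a) = a := by
  by_cases hζ : ζ = 0
  · simp [minimalSolution, hzero hζ]
  · have hnorm : ((‖ζ‖ ^ 2 : ℝ) : ℂ) ≠ 0 := by simpa using hζ
    have hhomotopy := wedge_contract_add_contract_wedge ζ a
    rw [hclosed, contract_zero, add_zero] at hhomotopy
    rw [minimalSolution, wedge_smul, hhomotopy, inv_smul_smul₀ hnorm]

lemma sum_norm_sq_minimalSolution {ζ : Cn n} {a : Finset (Fin n) → ℂ}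
    (hclosed : wedge ζ a = 0) :
    ∑ I, ‖minimalSolution ζ a I‖ ^ 2 = (‖ζ‖ ^ 2)⁻¹ * ∑ K, ‖a K‖ ^ 2 := by
  by_cases hζ : ζ = 0
  · simp [minimalSolution, hζ]
  · have hsolve : wedge ζ (minimalSolution ζ a) = a :=
      wedge_minimalSolution hclosed fun h => absurd h hζ
    have hadjoint := sum_contract_mul_conj ζ a (minimalSolution ζ a)
    have hnorm : ((‖ζ‖ ^ 2 : ℝ) : ℂ) ≠ 0 := by simpa using hζ
    have hcontract : contract ζ a = ((‖ζ‖ ^ 2 : ℝ) : ℂ) • minimalSolution ζ a := by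
      rw [minimalSolution, smul_inv_smul₀ hnorm]
    simp only [hsolve, hcontract, Pi.smul_apply, smul_eq_mul, mul_assoc, Complex.mul_conj',
      ← Finset.mul_sum] at hadjoint
    rw [eq_inv_mul_iff_mul_eq₀ (by simpa using hζ)]
    exact_mod_cast hadjoint

lemma aemeasurable_minimalSolution {α : Type*} [MeasurableSpace α] {μ : Measure α}
    {ζ : α → Cn n} {a : α → Finset (Fin n) → ℂ} (hζ : AEMeasurable ζ μ)
    (ha : ∀ K, AEMeasurable (fun x => a x K) μ) (I : Finset (Fin n)) :
    AEMeasurable (fun x => minimalSolution (ζ x) (a x) I) μ := by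
  have hcoord : ∀ k, AEMeasurable (fun x => ζ x k) μ := fun k =>
    (by fun_prop : Measurable fun z : Cn n => z k).comp_aemeasurable hζ
  simp only [minimalSolution, contract, Pi.smul_apply, smul_eq_mul]
  refine AEMeasurable.mul (by fun_prop) (Finset.aemeasurable_fun_sum _ fun k _ => ?_)
  exact ((Complex.continuous_conj.measurable.comp_aemeasurable (hcoord k)).const_mul _).mul (ha _)

/-- Extension by zero of coefficients indexed by multi-indices of one length. -/
def extendCoeff {q : ℕ} (a : MultiIndex n q → ℂ) (K : Finset (Fin n)) : ℂ :=
  if h : K.card = q then a ⟨K, h⟩ else 0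

@[simp]
lemma extendCoeff_coe {q : ℕ} (a : MultiIndex n q → ℂ) (K : MultiIndex n q) :
    extendCoeff a K.1 = a K := by
  simp [extendCoeff, K.2]

lemma extendCoeff_of_card_ne {q : ℕ} (a : MultiIndex n q → ℂ) {K : Finset (Fin n)}
    (hK : K.card ≠ q) : extendCoeff a K = 0 :=
  dif_neg hK

lemma extendCoeff_eq_zero {q : ℕ} {a : MultiIndex n q → ℂ} (ha : ∀ K, a K = 0) :
    extendCoeff a = 0 := by
  ext K
  simp [extendCoeff, ha]

lemma eq_extendCoeff_iff {q : ℕ} {a : MultiIndex n q → ℂ} {b : Finset (Fin n) → ℂ}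
    (hb : ∀ K, K.card ≠ q → b K = 0) : b = extendCoeff a ↔ ∀ K : MultiIndex n q, b K.1 = a K := by
  refine ⟨fun h K => by rw [h, extendCoeff_coe], fun h => funext fun K => ?_⟩
  by_cases hK : K.card = q
  · rw [h ⟨K, hK⟩, ← extendCoeff_coe a]
  · rw [hb K hK, extendCoeff_of_card_ne a hK]

lemma sum_norm_sq_extendCoeff {q : ℕ} (a : MultiIndex n q → ℂ) :
    ∑ K, ‖extendCoeff a K‖ ^ 2 = ∑ K, ‖a K‖ ^ 2 := by
  rw [← Finset.sum_subset (Finset.filter_subset (fun K => K.card = q) Finset.univ),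
    Finset.sum_subtype (p := fun K : Finset (Fin n) => K.card = q)
      (F := inferInstanceAs (Fintype (MultiIndex n q))) _ (by simp)]
  · simp only [extendCoeff_coe]
  · intro K _ hK
    rw [extendCoeff_of_card_ne a (by simpa using hK)]
    simp

lemma wedge_extendCoeff_coe {q : ℕ} (ζ : Cn n) (a : MultiIndex n q → ℂ)
    (K : MultiIndex n (q + 1)) :
    wedge ζ (extendCoeff a) K.1 = ∑ j : K.1, wedgeSign j.1 K.1 * ζ j.1 * a (K.erase j) := by
  rw [wedge, ← Finset.sum_coe_sort]
  exact Finset.sum_congr rfl fun j _ => by rw [← extendCoeff_coe a (K.erase j)]; rfl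

lemma wedge_extendCoeff_of_card_ne {q : ℕ} (ζ : Cn n) (a : MultiIndex n q → ℂ)
    {K : Finset (Fin n)} (hK : K.card ≠ q + 1) : wedge ζ (extendCoeff a) K = 0 := by
  refine Finset.sum_eq_zero fun j hj => ?_
  have hcard := Finset.card_erase_add_one hj
  rw [extendCoeff_of_card_ne a (by omega), mul_zero]

lemma minimalSolution_extendCoeff_of_card_ne {q : ℕ} (ζ : Cn n) (a : MultiIndex n (q + 1) → ℂ)
    {I : Finset (Fin n)} (hI : I.card ≠ q) : minimalSolution ζ (extendCoeff a) I = 0 := by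
  have hcontract : contract ζ (extendCoeff a) I = 0 := by
    refine Finset.sum_eq_zero fun k hk => ?_
    have hcard := Finset.card_insert_of_notMem (Finset.mem_compl.1 hk)
    rw [extendCoeff_of_card_ne a (by omega), mul_zero]
  rw [minimalSolution, Pi.smul_apply, hcontract, smul_zero]

end ExteriorAlgebra

section Dbar

variable {n q : ℕ}

/-- The Fourier symbol of `∂̄`: under the convention `f̂(ξ) = ∫ f(z) exp(-2πi⟨z, ξ⟩)`, the operator
`∂/∂z̄_j` becomes multiplication by `πi ξ_j`. -/
noncomputable def dbarSymbol (ξ : Cn n) : Cn n := (Real.pi * Complex.I : ℂ) • ξ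

lemma norm_dbarSymbol (ξ : Cn n) : ‖dbarSymbol ξ‖ = Real.pi * ‖ξ‖ := by
  simp [dbarSymbol, norm_smul, abs_of_pos Real.pi_pos]

lemma continuous_dbarSymbol : Continuous (dbarSymbol : Cn n → Cn n) := by
  unfold dbarSymbol
  fun_prop

lemma hasTemperateGrowth_dbarSymbol (j : Fin n) :
    (fun ξ : Cn n => dbarSymbol ξ j).HasTemperateGrowth := by
  have hlinear := ((Real.pi * Complex.I : ℂ) •
    (EuclideanSpace.proj j : Cn n →L[ℂ] ℂ)).restrictScalars ℝ |>.hasTemperateGrowth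
  exact hlinear

lemma inner_single (ξ : Cn n) (j : Fin n) (c : ℂ) :
    inner ℝ ξ (EuclideanSpace.single j c) = inner ℝ (ξ j) c := by
  rw [PiLp.inner_apply, Finset.sum_eq_single j (fun k _ hk => by simp [hk]) (by simp)]
  simp

lemma dzbar_fourier (j : Fin n) (h : 𝓢(Cn n, ℂ)) (z : Cn n) :
    dzbar j (𝓕 h : 𝓢(Cn n, ℂ)) z =
      -𝓕 (SchwartzMap.smulLeftCLM ℂ (fun ξ : Cn n => dbarSymbol ξ j) h) z := by
  let D (c : ℂ) : 𝓢(Cn n, ℂ) := -(2 * Real.pi * Complex.I) •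
    SchwartzMap.smulLeftCLM ℂ (inner ℝ · (EuclideanSpace.single j c : Cn n)) h
  have hfderiv : ∀ c, fderiv ℝ (𝓕 h : 𝓢(Cn n, ℂ)) z (EuclideanSpace.single j c) = 𝓕 (D c) z :=
    fun c => by rw [← SchwartzMap.lineDerivOp_apply_eq_fderiv, SchwartzMap.lineDerivOp_fourier_eq]
  have hgrowth : ∀ c, (inner ℝ · (EuclideanSpace.single j c : Cn n)).HasTemperateGrowth :=
    fun c => by fun_prop
  have hinner_one : ∀ ζ : ℂ, inner ℝ ζ 1 = ζ.re := fun ζ => by simp [Complex.inner]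
  have hinner_I : ∀ ζ : ℂ, inner ℝ ζ Complex.I = ζ.im := fun ζ => by simp [Complex.inner]
  have hsymbol : SchwartzMap.smulLeftCLM ℂ (fun ξ : Cn n => dbarSymbol ξ j) h =
      -((1 / 2 : ℂ) • (D 1 + Complex.I • D Complex.I)) := by
    ext ξ
    rw [SchwartzMap.smulLeftCLM_apply_apply (hasTemperateGrowth_dbarSymbol j)]
    simp only [D, neg_apply, smul_apply, add_apply,
      SchwartzMap.smulLeftCLM_apply_apply (hgrowth _)]
    simp only [inner_single, hinner_one, hinner_I, dbarSymbol, PiLp.smul_apply, smul_eq_mul,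
      Complex.real_smul]
    linear_combination -(Real.pi * Complex.I * h ξ) * Complex.re_add_im (ξ j)
  rw [dzbar, hfderiv, hfderiv, hsymbol]
  simp only [FourierTransform.fourier_smul, FourierTransform.fourier_add,
    FourierTransform.fourier_neg, neg_apply, smul_apply, add_apply, smul_eq_mul, neg_neg]

lemma integral_mul_dzbar_fourier {f : Cn n → ℂ} (hf : MemLp f 2 volume) (j : Fin n)
    (h : 𝓢(Cn n, ℂ)) :
    ∫ z, f z * dzbar j (𝓕 h : 𝓢(Cn n, ℂ)) z = -∫ ξ, dbarSymbol ξ j * h ξ * fourierL2 hf ξ := by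
  simp only [dzbar_fourier, mul_neg, integral_neg, integral_mul_fourier_eq hf,
    SchwartzMap.smulLeftCLM_apply_apply (hasTemperateGrowth_dbarSymbol j), smul_eq_mul]

lemma integrable_dbarSymbol_mul_mul_fourierL2 {f : Cn n → ℂ} (hf : MemLp f 2 volume) (j : Fin n)
    (h : 𝓢(Cn n, ℂ)) : Integrable fun ξ => dbarSymbol ξ j * h ξ * fourierL2 hf ξ := by
  refine (((SchwartzMap.smulLeftCLM ℂ (fun ξ : Cn n => dbarSymbol ξ j) h).memLp 2).integrable_mul
    (Lp.memLp (fourierL2 hf))).congr (.of_forall fun ξ => ?_)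
  rw [Pi.mul_apply, SchwartzMap.smulLeftCLM_apply_apply (hasTemperateGrowth_dbarSymbol j),
    smul_eq_mul]

/-- The Fourier transform of a square integrable form. -/
noncomputable def formFourier {u : AntiForm n q} (hu : u.IsL2) (ξ : Cn n) :
    Finset (Fin n) → ℂ :=
  extendCoeff fun J => fourierL2 (hu J) ξ

lemma memLp_formFourier {u : AntiForm n q} (hu : u.IsL2) (K : Finset (Fin n)) :
    MemLp (fun ξ => formFourier hu ξ K) 2 volume := by
  by_cases hK : K.card = q
  · simpa [formFourier, extendCoeff, hK] using Lp.memLp (fourierL2 (hu ⟨K, hK⟩))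
  · simp [formFourier, extendCoeff, hK]

lemma neg_sum_integral_mul_dzbar_fourier {u : AntiForm n q} (hu : u.IsL2)
    (K : MultiIndex n (q + 1)) (h : 𝓢(Cn n, ℂ)) :
    -∑ j : K.1, wedgeSign j.1 K.1 * ∫ z, u (K.erase j) z * dzbar j.1 (𝓕 h : 𝓢(Cn n, ℂ)) z =
      ∫ ξ, h ξ * wedge (dbarSymbol ξ) (formFourier hu ξ) K.1 := by
  simp only [formFourier, wedge_extendCoeff_coe, integral_mul_dzbar_fourier (hu _), mul_neg,
    Finset.sum_neg_distrib, neg_neg, Finset.mul_sum]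
  rw [integral_finsetSum]
  · refine Finset.sum_congr rfl fun j _ => ?_
    rw [← integral_const_mul]
    congr with ξ
    ring
  · intro j _
    refine ((integrable_dbarSymbol_mul_mul_fourierL2 (hu (K.erase j)) j.1 h).const_mul
      (wedgeSign j.1 K.1)).congr (.of_forall fun ξ => ?_)
    ring

lemma integral_mul_dzbar_eq {f φ : Cn n → ℂ} (j : Fin n)
    (hint : ∀ w, Integrable fun z => f z * fderiv ℝ φ z w) :
    ∫ z, f z * dzbar j φ z = (1 / 2 : ℂ) *
      ((∫ z, f z * fderiv ℝ φ z (EuclideanSpace.single j 1)) +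
        Complex.I * ∫ z, f z * fderiv ℝ φ z (EuclideanSpace.single j Complex.I)) := by
  rw [← integral_const_mul, ← integral_add (hint _) ((hint _).const_mul _), ← integral_const_mul]
  congr with z
  rw [dzbar]
  ring

lemma tendsto_integral_mul_dzbar_truncate {f : Cn n → ℂ} (hf : MemLp f 2 volume)
    (ψ : 𝓢(Cn n, ℂ)) (j : Fin n) :
    Tendsto (fun k => ∫ z, f z * dzbar j (truncate ψ k) z) atTop
      (𝓝 (∫ z, f z * dzbar j ψ z)) := by
  have hψ : ∀ w, Integrable fun z => f z * fderiv ℝ ψ z w := fun w =>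
    hf.integrable_mul (memLp_fderiv_schwartz ψ w)
  have htruncate : ∀ k w, Integrable fun z => f z * fderiv ℝ (truncate ψ k) z w := fun k w =>
    hf.integrable_mul (memLp_fderiv_schwartz
      ((hasCompactSupport_truncate ψ k).toSchwartzMap (contDiff_truncate ψ k)) w)
  simp only [integral_mul_dzbar_eq j hψ, fun k => integral_mul_dzbar_eq j (htruncate k)]
  exact ((tendsto_integral_mul_fderiv_truncate hf ψ _).add
    ((tendsto_integral_mul_fderiv_truncate hf ψ _).const_mul _)).const_mul _

lemma isDbar_iff_forall_schwartz {u : AntiForm n q} {v : AntiForm n (q + 1)} (hu : u.IsL2)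
    (hv : v.IsL2) : IsDbar u v ↔ ∀ (K : MultiIndex n (q + 1)) (ψ : 𝓢(Cn n, ℂ)),
      ∫ z, v K z * ψ z = -∑ j : K.1, wedgeSign j.1 K.1 * ∫ z, u (K.erase j) z * dzbar j.1 ψ z := by
  refine ⟨fun huv K ψ => ?_, fun h => ⟨fun J => (hu J).locallyIntegrable one_le_two,
    fun K => (hv K).locallyIntegrable one_le_two, fun K φ hφ hφc => h K (hφc.toSchwartzMap hφ)⟩⟩
  refine tendsto_nhds_unique (tendsto_integral_mul_truncate (hv K) ψ) ?_
  simp only [fun k => huv.2.2 K _ (contDiff_truncate ψ k) (hasCompactSupport_truncate ψ k)]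
  exact (tendsto_finsetSum _ fun j _ =>
    (tendsto_integral_mul_dzbar_truncate (hu (K.erase j)) ψ j.1).const_mul _).neg

lemma locallyIntegrable_wedge_formFourier {u : AntiForm n q} (hu : u.IsL2)
    (K : Finset (Fin n)) :
    LocallyIntegrable fun ξ => wedge (dbarSymbol ξ) (formFourier hu ξ) K := by
  refine locallyIntegrable_finsetSum _ fun j _ => locallyIntegrable_continuous_mul ?_
    ((memLp_formFourier hu _).locallyIntegrable one_le_two)
  exact continuous_const.mul (hasTemperateGrowth_dbarSymbol j).1.continuous

theorem isDbar_iff_formFourier {u : AntiForm n q} {v : AntiForm n (q + 1)} (hu : u.IsL2)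
    (hv : v.IsL2) :
    IsDbar u v ↔ ∀ᵐ ξ, wedge (dbarSymbol ξ) (formFourier hu ξ) = formFourier hv ξ := by
  have hcoeff : ∀ ξ, wedge (dbarSymbol ξ) (formFourier hu ξ) = formFourier hv ξ ↔
      ∀ K : MultiIndex n (q + 1),
        wedge (dbarSymbol ξ) (formFourier hu ξ) K.1 = fourierL2 (hv K) ξ := fun ξ =>
    eq_extendCoeff_iff fun K hK => wedge_extendCoeff_of_card_ne _ _ hK
  simp only [isDbar_iff_forall_schwartz hu hv, hcoeff, ae_all_iff]
  refine forall_congr' fun K => ⟨fun h => ?_, fun h ψ => ?_⟩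
  · refine ae_eq_of_forall_integral_schwartz_mul_eq (locallyIntegrable_wedge_formFourier hu K.1)
      ((Lp.memLp _).locallyIntegrable one_le_two) fun ψ => ?_
    rw [← integral_mul_fourier_eq (hv K), h, neg_sum_integral_mul_dzbar_fourier hu]
  · obtain ⟨h', rfl⟩ : ∃ h', 𝓕 h' = ψ := ⟨𝓕⁻ ψ, FourierTransform.fourier_fourierInv_eq ψ⟩
    rw [integral_mul_fourier_eq (hv K), neg_sum_integral_mul_dzbar_fourier hu]
    refine integral_congr_ae ?_
    filter_upwards [h] with ξ hξ
    rw [hξ]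

lemma IsDbarClosed.wedge_formFourier_eq_zero {v : AntiForm n q} (hclosed : IsDbarClosed v)
    (hv : v.IsL2) : ∀ᵐ ξ, wedge (dbarSymbol ξ) (formFourier hv ξ) = 0 := by
  have hzero : AntiForm.IsL2 fun (_ : MultiIndex n (q + 1)) (_ : Cn n) => (0 : ℂ) := fun _ =>
    MemLp.zero
  have hfourier : ∀ᵐ ξ, ∀ K, fourierL2 (hzero K) ξ = 0 := ae_all_iff.2 fun K => by
    have hnorm : fourierL2 (hzero K) = 0 := by
      simpa using norm_fourierL2_sq (hzero K)
    rw [hnorm]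
    exact Lp.coeFn_zero ℂ 2 volume
  filter_upwards [(isDbar_iff_formFourier hv hzero).1 hclosed, hfourier] with ξ hξ hξ0
  rw [hξ]
  exact extendCoeff_eq_zero hξ0

lemma integral_normSq_eq_integral_formFourier {u : AntiForm n q} (hu : u.IsL2) :
    ∫ z, u.normSq z = ∫ ξ, ∑ K, ‖formFourier hu ξ K‖ ^ 2 := by
  simp only [AntiForm.normSq, formFourier, sum_norm_sq_extendCoeff]
  rw [integral_finsetSum _ fun K _ => (hu K).integrable_norm_pow two_ne_zero,
    integral_finsetSum _ fun K _ => (Lp.memLp (fourierL2 (hu K))).integrable_norm_pow two_ne_zero]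
  simp only [← norm_fourierL2_sq (hu _), norm_sq_eq_integral_norm_sq]

lemma exists_formFourier_eq {b : Cn n → Finset (Fin n) → ℂ}
    (hb : ∀ I, MemLp (fun ξ => b ξ I) 2 volume) (hcard : ∀ ξ I, I.card ≠ q → b ξ I = 0) :
    ∃ (u : AntiForm n q) (hu : u.IsL2), ∀ᵐ ξ, formFourier hu ξ = b ξ := by
  choose u hu hub using fun I : MultiIndex n q => exists_fourierL2_eq ((hb I.1).toLp _)
  refine ⟨u, hu, ?_⟩
  filter_upwards [ae_all_iff.2 fun I : MultiIndex n q => (hb I.1).coeFn_toLp] with ξ hξ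
  refine ((eq_extendCoeff_iff (hcard ξ)).2 fun I => ?_).symm
  rw [hub, hξ]

lemma memLp_of_sum_norm_sq_le {α ι E : Type*} [MeasurableSpace α] {μ : Measure α} [Fintype ι]
    [NormedAddCommGroup E] {b : ι → α → E} {B : α → ℝ}
    (hb : ∀ i, AEStronglyMeasurable (b i) μ) (hB : Integrable B μ)
    (hle : ∀ᵐ x ∂μ, ∑ i, ‖b i x‖ ^ 2 ≤ B x) (i : ι) : MemLp (b i) 2 μ := by
  rw [memLp_two_iff_integrable_sq_norm (hb i)]
  refine hB.mono' ((hb i).norm.pow 2) ?_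
  filter_upwards [hle] with x hx
  rw [norm_pow, norm_norm]
  exact (Finset.single_le_sum (f := fun i => ‖b i x‖ ^ 2) (fun _ _ => sq_nonneg _)
    (Finset.mem_univ i)).trans hx

lemma sum_norm_sq_minimalSolution_dbarSymbol_le {ξ : Cn n} {a : Finset (Fin n) → ℂ} {B : ℝ}
    (hclosed : wedge (dbarSymbol ξ) a = 0) (hB : 0 ≤ B) (ha : ∑ K, ‖a K‖ ^ 2 = ‖ξ‖ ^ 2 * B) :
    ∑ I, ‖minimalSolution (dbarSymbol ξ) a I‖ ^ 2 ≤ (Real.pi ^ 2)⁻¹ * B := by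
  rw [sum_norm_sq_minimalSolution hclosed, norm_dbarSymbol, ha, mul_pow, mul_inv, mul_assoc]
  gcongr
  exact inv_mul_le_of_le_mul₀ (sq_nonneg _) hB le_rfl

theorem exists_isDbar_of_fourierL2_eq_norm_mul {v : AntiForm n (q + 1)}
    (hclosed : IsDbarClosed v) (hv : v.IsL2)
    {F : MultiIndex n (q + 1) → Lp (α := Cn n) ℂ 2 volume}
    (hvF : ∀ K, ∀ᵐ ξ, fourierL2 (hv K) ξ = ‖ξ‖ * F K ξ) :
    ∃ u : AntiForm n q, u.IsL2 ∧ IsDbar u v ∧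
      ∫ z, u.normSq z ≤ (Real.pi ^ 2)⁻¹ * ∑ K, ‖F K‖ ^ 2 := by
  let b (ξ : Cn n) : Finset (Fin n) → ℂ := minimalSolution (dbarSymbol ξ) (formFourier hv ξ)
  have hwedge := hclosed.wedge_formFourier_eq_zero hv
  have hFint : ∀ K, Integrable fun ξ => ‖F K ξ‖ ^ 2 := fun K =>
    (Lp.memLp (F K)).integrable_norm_pow two_ne_zero
  have hBint : Integrable fun ξ => (Real.pi ^ 2)⁻¹ * ∑ K, ‖F K ξ‖ ^ 2 :=
    (integrable_finsetSum _ fun K _ => hFint K).const_mul _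
  have hb_le : ∀ᵐ ξ, ∑ I, ‖b ξ I‖ ^ 2 ≤ (Real.pi ^ 2)⁻¹ * ∑ K, ‖F K ξ‖ ^ 2 := by
    filter_upwards [hwedge, ae_all_iff.2 hvF] with ξ hξ hξF
    refine sum_norm_sq_minimalSolution_dbarSymbol_le hξ (by positivity) ?_
    simp [formFourier, sum_norm_sq_extendCoeff, hξF, mul_pow, Finset.mul_sum]
  have hb_memLp : ∀ I, MemLp (fun ξ => b ξ I) 2 volume :=
    memLp_of_sum_norm_sq_le (fun I => (aemeasurable_minimalSolution
      continuous_dbarSymbol.aemeasurable (fun K => (memLp_formFourier hv K).1.aemeasurable)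
      I).aestronglyMeasurable) hBint hb_le
  obtain ⟨u, hu, hub⟩ := exists_formFourier_eq hb_memLp fun ξ I hI =>
    minimalSolution_extendCoeff_of_card_ne (dbarSymbol ξ) _ hI
  refine ⟨u, hu, (isDbar_iff_formFourier hu hv).2 ?_, ?_⟩
  · filter_upwards [hub, hwedge, ae_all_iff.2 hvF] with ξ hξu hξ hξF
    rw [hξu]
    refine wedge_minimalSolution hξ fun h0 => ?_
    have hξ0 : ξ = 0 := by simpa [dbarSymbol, Real.pi_ne_zero] using h0
    refine extendCoeff_eq_zero fun K => ?_
    rw [hξF, norm_eq_zero.2 hξ0, Complex.ofReal_zero, zero_mul]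
  · calc ∫ z, u.normSq z = ∫ ξ, ∑ I, ‖formFourier hu ξ I‖ ^ 2 :=
          integral_normSq_eq_integral_formFourier hu
      _ ≤ ∫ ξ, (Real.pi ^ 2)⁻¹ * ∑ K, ‖F K ξ‖ ^ 2 := by
          refine integral_mono_of_nonneg (.of_forall fun ξ => by positivity) hBint ?_
          filter_upwards [hub, hb_le] with ξ hξu hξ
          rwa [hξu]
      _ = (Real.pi ^ 2)⁻¹ * ∑ K, ‖F K‖ ^ 2 := by
          rw [integral_const_mul, integral_finsetSum _ fun K _ => hFint K]
          simp only [norm_sq_eq_integral_norm_sq]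

lemma integrable_norm_sq_mul_of_normSq {v : AntiForm n q} {w : Cn n → ℝ} (hv : v.IsL2)
    (hw : Measurable w) (hw0 : ∀ z, 0 ≤ w z) (hvw : Integrable fun z => v.normSq z * w z)
    (K : MultiIndex n q) : Integrable fun z => ‖v K z‖ ^ 2 * w z := by
  refine hvw.mono' (((hv K).1.norm.pow 2).mul hw.aestronglyMeasurable) (.of_forall fun z => ?_)
  rw [Real.norm_of_nonneg (mul_nonneg (sq_nonneg _) (hw0 z))]
  exact mul_le_mul_of_nonneg_right (Finset.single_le_sum (f := fun K => ‖v K z‖ ^ 2)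
    (fun _ _ => sq_nonneg _) (Finset.mem_univ K)) (hw0 z)

theorem IsHardyWeight.exists_isDbar {w : Cn n → ℝ} {C : ℝ} (hw : IsHardyWeight w C)
    {v : AntiForm n (q + 1)} (hclosed : IsDbarClosed v) (hv : v.IsL2)
    (hvw : Integrable fun z => v.normSq z * w z) :
    ∃ u : AntiForm n q, u.IsL2 ∧ IsDbar u v ∧
      ∫ z, u.normSq z ≤ 4 * C * ∫ z, v.normSq z * w z := by
  have hvwK := integrable_norm_sq_mul_of_normSq hv hw.measurable hw.nonneg hvw
  choose F hF hvF using fun K => hw.exists_fourierL2_eq_norm_mul (hv K) (hvwK K)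
  obtain ⟨u, hu, huv, hle⟩ := exists_isDbar_of_fourierL2_eq_norm_mul hclosed hv hvF
  refine ⟨u, hu, huv, hle.trans ?_⟩
  calc (Real.pi ^ 2)⁻¹ * ∑ K, ‖F K‖ ^ 2
      ≤ (Real.pi ^ 2)⁻¹ * ∑ K, 4 * Real.pi ^ 2 * C * ∫ z, ‖v K z‖ ^ 2 * w z := by
        gcongr with K
        exact hF K
    _ = 4 * C * ∑ K, ∫ z, ‖v K z‖ ^ 2 * w z := by
        rw [← Finset.mul_sum]
        field_simp
    _ = 4 * C * ∫ z, v.normSq z * w z := by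
        rw [← integral_finsetSum _ fun K _ => hvwK K]
        simp only [AntiForm.normSq, Finset.sum_mul]

end Dbar

theorem corollary2p3 (n m q : ℕ) (H : AffineSubspace ℝ (Cn n)) (hne : (H : Set (Cn n)).Nonempty)
    (hcodim : Module.finrank ℝ (Cn n ⧸ H.direction) = m) (hm : 3 ≤ m)
    (v : AntiForm n (q + 1)) (hclosed : IsDbarClosed v) (hv : v.IsL2)
    (hvH : Integrable (fun z => v.normSq z * Metric.infDist z (H : Set (Cn n)) ^ 2) volume) :
    ∃ u : AntiForm n q, u.IsL2 ∧ IsDbar u v ∧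
      ∫ z, u.normSq z ≤
        16 / ((m : ℝ) - 2) ^ 2 *
          ∫ z, v.normSq z * Metric.infDist z (H : Set (Cn n)) ^ 2 := by
  obtain ⟨u, hu, huv, hle⟩ :=
    (isHardyWeight_infDist_sq hne hcodim hm).exists_isDbar hclosed hv hvH
  refine ⟨u, hu, huv, hle.trans_eq ?_⟩
  ring
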